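/- Let $F$ be a field of characteristic $2$, let $[F:F^2]\in\mathbb{N}\cup\{\infty\}$ be its degree over the subfield $F^2$ of squares, and let $Q$ be an $F$-quaternion division algebra (a central division $F$-algebra of dimension $4$ over $F$). Let $\theta$ be any $F$-involution on $Q$, i.e. an $F$-linear map with $\theta(xy)=\theta(y)\theta(x)$ and $\theta^2=\mathrm{id}$, and put $\mathrm{Alt}(Q,\theta)=\{a-\theta(a)\mid a\in Q\}$. A hermitian form over $(Q,\theta)$ is a bi-additive map $h:V\times V\to Q$ on a finite-dimensional right $Q$-vector space $V$ with $h(xd_1,yd_2)=\theta(d_1)h(x,y)d_2$ and $h(y,x)=\theta(h(x,y))$; it is anisotropic if $h(x,x)\neq 0$ for all $x\neq 0$. A (generalised) quadratic form over $(Q,\theta)$ is a map $q:V\to Q/\mathrm{Alt}(Q,\theta)$ on such a $V$ with $q(xd)=\theta(d)q(x)d$ and such that $q(x+y)-q(x)-q(y)=h(x,y)+\mathrm{Alt}(Q,\theta)$ for some hermitian form $h$ over $(Q,\theta)$; it is anisotropic if $q(x)\neq 0$ for all $x\neq 0$. Let $u^+(Q)$ and $u(Q)$ in $\mathbb{N}\cup\{\infty\}$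 be the suprema of $\dim_Q V$ over all anisotropic hermitian forms, respectively all anisotropic quadratic forms, over $(Q,\theta)$ (possibly singular). These suprema do not depend on the choice of $\theta$. Then $$u^+(Q)\leqslant [F:F^2]\qquad\text{and}\qquad u(Q)\leqslant \tfrac{3}{2}\,[F:F^2].$$ -/

import Mathlib

open scoped ENNReal

noncomputable section

namespace GenForm

universe u v w

/-- An `F`-involution on an `F`-algebra `D`: an `F`-linear map `θ : D → D` with
`θ (x * y) = θ y * θ x` and `θ (θ x) = x`. -/
structure FInvolution (F : Type u) (D : Type v) [Field F] [Ring D] [Algebra F D]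
    extends D →ₗ[F] D where
  map_mul_rev' : ∀ x y : D, toFun (x * y) = toFun y * toFun x
  involutive' : ∀ x : D, toFun (toFun x) = x

section

variable {F : Type u} {D : Type v} [Field F] [Ring D] [Algebra F D]

instance : CoeFun (FInvolution F D) (fun _ => D → D) := ⟨fun θ => θ.toLinearMap⟩

/-- `Alt(D, θ) = {a - θ a | a ∈ D}`, an `F`-subspace of `D`. -/
def Alt (θ : FInvolution F D) : Submodule F D :=
  LinearMap.range (LinearMap.id - θ.toLinearMap)

/-- The `F`-linear map `a ↦ θ d * a * d` on `D`. -/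
def conjMap (θ : FInvolution F D) (d : D) : D →ₗ[F] D :=
  LinearMap.mulLeft F (θ d) ∘ₗ LinearMap.mulRight F d

theorem alt_le_comap_conjMap (θ : FInvolution F D) (d : D) :
    Alt θ ≤ (Alt θ).comap (conjMap θ d) := by
  rintro _ ⟨a, rfl⟩
  refine ⟨θ d * (a * d), ?_⟩
  have h1 : θ (θ d * (a * d)) = θ d * (θ a * d) := by
    have e1 := θ.map_mul_rev' (θ d) (a * d)
    have e2 := θ.map_mul_rev' a d
    have e3 := θ.involutive' d
    change θ (θ d * (a * d)) = θ (a * d) * θ (θ d) at e1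
    change θ (a * d) = θ d * θ a at e2
    change θ (θ d) = d at e3
    rw [e1, e2, e3, mul_assoc]
  simp only [conjMap, LinearMap.sub_apply, LinearMap.id_apply, LinearMap.comp_apply,
    LinearMap.mulLeft_apply, LinearMap.mulRight_apply, sub_mul, mul_sub]
  rw [h1]

/-- The map `D / Alt(D, θ) → D / Alt(D, θ)` induced by `a ↦ θ d * a * d`. -/
def conjQuot (θ : FInvolution F D) (d : D) : (D ⧸ Alt θ) →ₗ[F] (D ⧸ Alt θ) :=
  (Alt θ).mapQ (Alt θ) (conjMap θ d) (alt_le_comap_conjMap θ d)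

/-- A hermitian form over `(D, θ)` on the right `D`-module `V`: a bi-additive map `h : V × V → D`
with `h (x d₁, y d₂) = θ(d₁) h(x, y) d₂` and `h(y, x) = θ(h(x, y))`.
Right `D`-modules are modules over `Dᵐᵒᵖ`. -/
structure HermForm (θ : FInvolution F D) (V : Type w) [AddCommGroup V] [Module Dᵐᵒᵖ V] where
  form : V →+ V →+ D
  map_smul_smul : ∀ (x y : V) (d₁ d₂ : D),
    form (MulOpposite.op d₁ • x) (MulOpposite.op d₂ • y) = θ d₁ * form x y * d₂
  symm : ∀ x y : V, form y x = θ (form x y)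

/-- A hermitian form is anisotropic if `h(x, x) ≠ 0` for all `x ≠ 0`. -/
def HermForm.IsAnisotropic {θ : FInvolution F D} {V : Type w} [AddCommGroup V] [Module Dᵐᵒᵖ V]
    (φ : HermForm θ V) : Prop :=
  ∀ x : V, x ≠ 0 → φ.form x x ≠ 0

/-- A (generalised) quadratic form over `(D, θ)` on the right `D`-module `V`: a map
`q : V → D / Alt(D, θ)` with `q(x d) = θ(d) q(x) d`, and such that
`q(x + y) - q(x) - q(y) = h(x, y) + Alt(D, θ)` for some hermitian form `h` over `(D, θ)`. -/
structure QuadForm (θ : FInvolution F D) (V : Type w) [AddCommGroup V] [Module Dᵐᵒᵖ V] where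
  form : V → D ⧸ Alt θ
  map_smul : ∀ (x : V) (d : D), form (MulOpposite.op d • x) = conjQuot θ d (form x)
  exists_polar : ∃ φ : HermForm θ V, ∀ x y : V,
    form (x + y) - form x - form y = (Alt θ).mkQ (φ.form x y)

/-- A quadratic form is anisotropic if `q(x) ≠ 0` in `D / Alt(D, θ)` for all `x ≠ 0`. -/
def QuadForm.IsAnisotropic {θ : FInvolution F D} {V : Type w} [AddCommGroup V] [Module Dᵐᵒᵖ V]
    (ρ : QuadForm θ V) : Prop :=
  ∀ x : V, x ≠ 0 → ρ.form x ≠ 0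

end

section

variable {F : Type u} {D : Type v} [Field F] [DivisionRing D] [Algebra F D]

/-- The invariant `u⁺`, computed with the involution `θ`: the supremum in `ℕ ∪ {∞}` of the
dimensions of the anisotropic hermitian forms over `(D, θ)` on finite-dimensional right
`D`-vector spaces. -/
def uPlus (θ : FInvolution F D) : ℕ∞ :=
  sSup {n : ℕ∞ | ∃ (V : Type v) (_ : AddCommGroup V) (_ : Module Dᵐᵒᵖ V)
    (_ : Module.Finite Dᵐᵒᵖ V) (φ : HermForm θ V),
    φ.IsAnisotropic ∧ n = (Module.finrank Dᵐᵒᵖ V : ℕ∞)}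

/-- The invariant `u`, computed with the involution `θ`: the supremum in `ℕ ∪ {∞}` of the
dimensions of the anisotropic quadratic forms over `(D, θ)` on finite-dimensional right
`D`-vector spaces. -/
def uInv (θ : FInvolution F D) : ℕ∞ :=
  sSup {n : ℕ∞ | ∃ (V : Type v) (_ : AddCommGroup V) (_ : Module Dᵐᵒᵖ V)
    (_ : Module.Finite Dᵐᵒᵖ V) (ρ : QuadForm θ V),
    ρ.IsAnisotropic ∧ n = (Module.finrank Dᵐᵒᵖ V : ℕ∞)}

end

/-- `[F : F²] ∈ ℕ ∪ {∞}`, the degree of `F` over its subfield of squares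
(the image of the Frobenius endomorphism), for `F` of characteristic two. -/
def degSq (F : Type u) [Field F] [CharP F 2] : ℕ∞ :=
  Cardinal.toENat (Module.rank (frobenius F 2).fieldRange F)

end GenForm

end

/-!
In characteristic two a quadratic map whose polar form vanishes is additive, hence semilinear for
the Frobenius of `F`; if it is moreover anisotropic, it embeds `V` into its target `M` and gives
`dim V ≤ [F : F²] dim M`. Everything is reduced to this remark.

Write `a = dim Alt` and `s = dim (Sym / Alt)`. An anisotropic quadratic map over `F` with values in
`Alt` has dimension at most `a (a + 1) [F : F²]`: restrict it to a maximal subspace that is totally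
isotropic for the polar form. For a hermitian form `h`, the map `x ↦ h x x` is Frobenius semilinear
modulo `Alt`, and its kernel falls under the previous bound. For a quadratic form `q` with polar
form `h`, take a maximal totally isotropic subspace `W` for `h` and a complement `C` of `W` in its
orthogonal, so that `dim V ≤ 2 dim W + dim C`. The subspace `C` falls under the bound, as
`h x x ∈ Alt`, while `q` is Frobenius semilinear on `W` with values in `Sym / Alt`. A
quaternion algebra has `a = 1` and `s = 2`, because an involution whose symmetric elements commute
with each other has only central ones.
-/

namespace GenForm

open Module Function
open QuadraticMap (polar polar_comm polar_comp polar_self polarBilin_apply_apply)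

theorem add_self_eq_zero_of_charTwo (R : Type*) {M : Type*} [Semiring R] [CharP R 2]
    [AddCommMonoid M] [Module R M] (x : M) : x + x = 0 := by
  rw [← two_smul R x, CharTwo.two_eq_zero, zero_smul]

theorem add_eq_sub_of_charTwo (R : Type*) {M : Type*} [Semiring R] [CharP R 2]
    [AddCommGroup M] [Module R M] (x y : M) : x + y = x - y := by
  rw [eq_sub_iff_add_eq, add_assoc, add_self_eq_zero_of_charTwo R, add_zero]

section Semilinear

variable {K L : Type*} [Field K] [Field L] {σ : K →+* L} {V M : Type*}
  [AddCommGroup V] [Module K V] [AddCommGroup M] [Module L M]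
  [Module.Finite L M] [Module.Finite σ.fieldRange L]

theorem finrank_le_of_injective_semilinear (f : V →ₛₗ[σ] M) (hf : Injective f) :
    finrank K V ≤ finrank σ.fieldRange L * finrank L M := by
  have : Module.Finite σ.fieldRange M := Module.Finite.trans L M
  have hσ : Surjective σ.rangeRestrictField := fun ⟨_, r, hr⟩ => ⟨r, Subtype.ext hr⟩
  have hrank := lift_rank_le_of_surjective_injective (R := K) (R' := σ.fieldRange)
    σ.rangeRestrictField (f : V →+ M) hσ hf fun c x => f.map_smulₛₗ c x
  rw [finrank_mul_finrank]
  simpa only [finrank, Cardinal.toNat_lift] using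
    Cardinal.toNat_le_toNat hrank (Cardinal.lift_lt_aleph0.2 (rank_lt_aleph0 σ.fieldRange M))

theorem finrank_le_finrank_ker_add [Module.Finite K V] (f : V →ₛₗ[σ] M) :
    finrank K V ≤ finrank K (LinearMap.ker f) + finrank σ.fieldRange L * finrank L M := by
  rw [← (LinearMap.ker f).finrank_quotient_add_finrank, add_comm]
  gcongr
  exact finrank_le_of_injective_semilinear ((LinearMap.ker f).liftQ f le_rfl)
    (LinearMap.ker_eq_bot.1 (Submodule.ker_liftQ_eq_bot' _ _ rfl))

end Semilinear

section Orthogonal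

variable {K V P : Type*} [DivisionRing K] [AddCommGroup V] [Module K V]
  [AddCommGroup P] [Module K P]

/-- The right orthogonal `{y | ∀ x ∈ W, ψ x y = 0}` of a subspace. Only linearity in the second
variable is asked for, so that `ψ` may be bilinear or sesquilinear. -/
def orthogonal (ψ : V → V →ₗ[K] P) (W : Submodule K V) : Submodule K V :=
  ⨅ x : W, LinearMap.ker (ψ x)

variable {ψ : V → V →ₗ[K] P}

theorem mem_orthogonal {W : Submodule K V} {y : V} :
    y ∈ orthogonal ψ W ↔ ∀ x ∈ W, ψ x y = 0 := by
  simp only [orthogonal, Submodule.mem_iInf, LinearMap.mem_ker, Subtype.forall]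

theorem le_orthogonal_comm (hψ : ∀ x y, ψ x y = 0 → ψ y x = 0) {U W : Submodule K V} :
    U ≤ orthogonal ψ W ↔ W ≤ orthogonal ψ U := by
  simp only [SetLike.le_def, mem_orthogonal]
  exact ⟨fun h x hx y hy => hψ _ _ (h hy x hx), fun h x hx y hy => hψ _ _ (h hy x hx)⟩

theorem sup_le_orthogonal_sup (hψ : ∀ x y, ψ x y = 0 → ψ y x = 0) {U W : Submodule K V}
    (hU : U ≤ orthogonal ψ U) (hW : W ≤ orthogonal ψ W) (hUW : U ≤ orthogonal ψ W) :
    U ⊔ W ≤ orthogonal ψ (U ⊔ W) :=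
  sup_le ((le_orthogonal_comm hψ).1 (sup_le hU ((le_orthogonal_comm hψ).1 hUW)))
    ((le_orthogonal_comm hψ).1 (sup_le hUW hW))

theorem span_singleton_le_orthogonal (hψ : ∀ x y, ψ x y = 0 → ψ y x = 0) {c : V}
    (hc : ψ c c = 0) : K ∙ c ≤ orthogonal ψ (K ∙ c) := by
  have hspan : K ∙ c ≤ LinearMap.ker (ψ c) := (Submodule.span_singleton_le_iff_mem ..).2 hc
  exact (Submodule.span_singleton_le_iff_mem ..).2
    (mem_orthogonal.2 fun x hx => hψ _ _ (hspan hx))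

variable [Module.Finite K V]

theorem exists_isotropic_of_forall_mem (hψ : ∀ x y, ψ x y = 0 → ψ y x = 0) :
    ∃ W ≤ orthogonal ψ W, ∀ c ∈ orthogonal ψ W, ψ c c = 0 → c ∈ W := by
  obtain ⟨W, hW, hmax⟩ := WellFounded.has_min (wellFounded_gt (α := Submodule K V))
    {W | W ≤ orthogonal ψ W} ⟨⊥, show ⊥ ≤ orthogonal ψ ⊥ from bot_le⟩
  refine ⟨W, hW, fun c hc hcc => ?_⟩
  have hsup : W ⊔ K ∙ c ≤ orthogonal ψ (W ⊔ K ∙ c) :=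
    sup_le_orthogonal_sup hψ hW (span_singleton_le_orthogonal hψ hcc)
      ((le_orthogonal_comm hψ).1 ((Submodule.span_singleton_le_iff_mem ..).2 hc))
  have heq : W = W ⊔ K ∙ c := eq_of_le_of_not_lt le_sup_left (hmax _ hsup)
  exact heq.ge (Submodule.mem_sup_right (Submodule.mem_span_singleton_self c))

variable [Module.Finite K P]

theorem finrank_le_finrank_mul_add_orthogonal (hψ : ∀ x y, ψ x y = 0 → ψ y x = 0)
    (W : Submodule K V) :
    finrank K V ≤ finrank K W * finrank K P + finrank K (orthogonal ψ W) := by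
  let b := finBasis K W
  let Φ : V →ₗ[K] Fin (finrank K W) → P := LinearMap.pi fun i => ψ (b i)
  have hker : LinearMap.ker Φ ≤ orthogonal ψ W := fun y hy => mem_orthogonal.2 fun x hx => by
    have hb : ∀ i, ψ y (b i) = 0 := fun i => hψ _ _ (congrFun (LinearMap.mem_ker.1 hy) i)
    have hW : (ψ y).comp W.subtype = 0 := b.ext hb
    exact hψ _ _ (LinearMap.congr_fun hW ⟨x, hx⟩)
  have hrange : finrank K (LinearMap.range Φ) ≤ finrank K W * finrank K P := by
    simpa [finrank_pi_fintype] using (LinearMap.range Φ).finrank_le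
  rw [← Φ.finrank_range_add_finrank_ker]
  exact add_le_add hrange (Submodule.finrank_mono hker)

theorem exists_isotropic_anisotropic (hψ : ∀ x y, ψ x y = 0 → ψ y x = 0) :
    ∃ W C : Submodule K V, W ≤ orthogonal ψ W ∧ (∀ x ∈ C, ψ x x = 0 → x = 0) ∧
      finrank K V ≤ (finrank K P + 1) * finrank K W + finrank K C := by
  obtain ⟨W, hW, hmax⟩ := exists_isotropic_of_forall_mem hψ
  obtain ⟨U, hU⟩ := W.exists_isCompl
  have hsup : W ⊔ U ⊓ orthogonal ψ W = orthogonal ψ W := by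
    rw [← sup_inf_assoc_of_le U hW, hU.sup_eq_top, top_inf_eq]
  refine ⟨W, U ⊓ orthogonal ψ W, hW, fun x hx hxx => ?_, ?_⟩
  · exact Submodule.disjoint_def.1 hU.disjoint x (hmax x hx.2 hxx) hx.1
  · have hV := finrank_le_finrank_mul_add_orthogonal hψ W
    have hC := Submodule.finrank_add_le_finrank_add_finrank W (U ⊓ orthogonal ψ W)
    rw [hsup] at hC
    linarith

end Orthogonal

section QuadraticMap

variable {F V P : Type*} [Field F] [CharP F 2] [AddCommGroup V] [Module F V]
  [AddCommGroup P] [Module F P]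

/-- A quadratic map with vanishing polar form over a field of characteristic two, seen as a
semilinear map for the Frobenius endomorphism. -/
def frobeniusSemilinear (q : QuadraticMap F V P) (hq : ∀ x y, polar q x y = 0) :
    V →ₛₗ[frobenius F 2] P where
  toFun := q
  map_add' x y := by rw [QuadraticMap.map_add q, hq, add_zero]
  map_smul' c x := by rw [q.map_smul, frobenius_def, pow_two]

variable [Module.Finite F P] [Module.Finite (frobenius F 2).fieldRange F]

theorem finrank_le_of_anisotropic_of_polar_eq_zero {q : QuadraticMap F V P} (hq : q.Anisotropic)
    (hpolar : ∀ x y, polar q x y = 0) {N : Submodule F P} (hN : ∀ x, q x ∈ N) :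
    finrank F V ≤ finrank (frobenius F 2).fieldRange F * finrank F N :=
  finrank_le_of_injective_semilinear ((frobeniusSemilinear q hpolar).codRestrict N hN)
    ((injective_iff_map_eq_zero _).2 fun x hx => hq x (congrArg Subtype.val hx))

variable [Module.Finite F V]

theorem finrank_le_of_anisotropic {q : QuadraticMap F V P} (hq : q.Anisotropic) :
    finrank F V ≤ (finrank F P + 1) * (finrank (frobenius F 2).fieldRange F * finrank F P) := by
  have hrefl : ∀ x y, q.polarBilin x y = 0 → q.polarBilin y x = 0 := fun x y h =>
    (polar_comm q y x).trans h
  have halt : ∀ x, q.polarBilin x x = 0 := fun x => by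
    rw [polarBilin_apply_apply, polar_self, two_nsmul, add_self_eq_zero_of_charTwo F]
  obtain ⟨W, C, hW, hC, hle⟩ := exists_isotropic_anisotropic hrefl
  have hC_bot : C = ⊥ := (Submodule.eq_bot_iff C).2 fun x hx => hC x hx (halt x)
  have hW_le := finrank_le_of_anisotropic_of_polar_eq_zero (q := q.comp W.subtype) (N := ⊤)
    (fun x hx => Subtype.ext (hq x hx)) (fun x y => mem_orthogonal.1 (hW y.2) x x.2)
    fun _ => Submodule.mem_top
  rw [hC_bot, finrank_bot, add_zero] at hle
  rw [finrank_top] at hW_le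
  exact hle.trans (Nat.mul_le_mul_left _ hW_le)

theorem finrank_le_of_anisotropic_of_mem {q : QuadraticMap F V P} (hq : q.Anisotropic)
    {N : Submodule F P} (hN : ∀ x, q x ∈ N) :
    finrank F V ≤ (finrank F N + 1) * (finrank (frobenius F 2).fieldRange F * finrank F N) := by
  obtain ⟨π, hπ⟩ := N.subtype.exists_leftInverse_of_injective N.ker_subtype
  refine finrank_le_of_anisotropic (q := π.compQuadraticMap q) fun x hx => hq x ?_
  have hqx : π (q x) = ⟨q x, hN x⟩ := LinearMap.congr_fun hπ ⟨q x, hN x⟩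
  exact congrArg Subtype.val (hqx.symm.trans hx)

end QuadraticMap

section Involution

variable {F D : Type*} [Field F] [Ring D] [Algebra F D] (θ : FInvolution F D)

theorem FInvolution.apply_mul (x y : D) : θ (x * y) = θ y * θ x := θ.map_mul_rev' x y

theorem FInvolution.apply_apply (x : D) : θ (θ x) = x := θ.involutive' x

theorem FInvolution.apply_one : θ 1 = 1 := by
  have h := θ.apply_mul (θ 1) 1
  rwa [mul_one, θ.apply_apply, mul_one, eq_comm] at h

/-- `Sym(D, θ) = {a | θ a = a}`, an `F`-subspace of `D`. -/
def Sym : Submodule F D := LinearMap.ker (LinearMap.id - θ.toLinearMap)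

/-- The image `Sym(D, θ) / Alt(D, θ)` of the symmetric elements in `D / Alt(D, θ)`; in
characteristic two, where `Alt(D, θ) ⊆ Sym(D, θ)`, this is the genuine quotient. -/
def SymModAlt : Submodule F (D ⧸ Alt θ) := (Sym θ).map (Alt θ).mkQ

variable {θ}

theorem FInvolution.apply_ne_zero {x : D} (hx : x ≠ 0) : θ x ≠ 0 := fun h =>
  hx (by rw [← θ.apply_apply x, h, map_zero])

theorem mem_sym {x : D} : x ∈ Sym θ ↔ θ x = x := by
  rw [Sym, LinearMap.mem_ker, LinearMap.sub_apply, LinearMap.id_apply, sub_eq_zero, eq_comm]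

theorem one_mem_sym : 1 ∈ Sym θ := mem_sym.2 θ.apply_one

theorem sub_apply_mem_alt (x : D) : x - θ x ∈ Alt θ := ⟨x, rfl⟩

theorem conjQuot_mkQ (d a : D) :
    conjQuot θ d ((Alt θ).mkQ a) = (Alt θ).mkQ (θ d * (a * d)) := rfl

theorem conjQuot_algebraMap (c : F) (z : D ⧸ Alt θ) :
    conjQuot θ (algebraMap F D c) z = (c * c) • z := by
  obtain ⟨a, rfl⟩ := (Alt θ).mkQ_surjective z
  rw [conjQuot_mkQ, ← map_smul, Algebra.algebraMap_eq_smul_one, map_smul, θ.apply_one,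
    smul_one_mul, mul_smul_comm, mul_one, smul_smul]

theorem finrank_alt_add_finrank_sym [Module.Finite F D] :
    finrank F (Alt θ) + finrank F (Sym θ) = finrank F D :=
  LinearMap.finrank_range_add_finrank_ker _

variable [CharP F 2]

theorem add_apply_mem_alt (x : D) : x + θ x ∈ Alt θ := by
  rw [add_eq_sub_of_charTwo F]
  exact sub_apply_mem_alt x

theorem alt_le_sym : Alt θ ≤ Sym θ := by
  rintro _ ⟨a, rfl⟩
  rw [LinearMap.sub_apply, LinearMap.id_apply, mem_sym, map_sub, θ.apply_apply,
    ← add_eq_sub_of_charTwo F, ← add_eq_sub_of_charTwo F, add_comm]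

theorem alt_ne_top [Nontrivial D] : Alt θ ≠ ⊤ := by
  intro htop
  obtain ⟨a, ha⟩ : (1 : D) ∈ Alt θ := htop ▸ Submodule.mem_top
  have hfix : a ∈ Sym θ := alt_le_sym (htop ▸ Submodule.mem_top)
  rw [LinearMap.sub_apply, LinearMap.id_apply, mem_sym.1 hfix, sub_self] at ha
  exact zero_ne_one ha

theorem finrank_symModAlt_add [Module.Finite F D] :
    finrank F (SymModAlt θ) + 2 * finrank F (Alt θ) = finrank F D := by
  have hSym : finrank F (SymModAlt θ) + finrank F (Alt θ) = finrank F (Sym θ) := by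
    rw [← ((Alt θ).mkQ.domRestrict (Sym θ)).finrank_range_add_finrank_ker,
      LinearMap.range_domRestrict, LinearMap.ker_domRestrict, Submodule.ker_mkQ,
      (Submodule.comapSubtypeEquivOfLe alt_le_sym).finrank_eq]
    rfl
  have hD := finrank_alt_add_finrank_sym (θ := θ)
  omega

end Involution

section CommutingSymmetric

variable {F D : Type*} [Field F] [DivisionRing D] [Algebra F D] {θ : FInvolution F D}

theorem FInvolution.apply_inv (x : D) : θ x⁻¹ = (θ x)⁻¹ := by
  obtain rfl | hx := eq_or_ne x 0
  · rw [inv_zero, map_zero, inv_zero]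
  · refine eq_inv_of_mul_eq_one_left ?_
    rw [← θ.apply_mul, mul_inv_cancel₀ hx, θ.apply_one]

theorem mul_comm_of_finrank_le_two {F A : Type*} [Field F] [Ring A] [Nontrivial A]
    [Algebra F A] {S : Submodule F A} [Module.Finite F S]
    (hS : finrank F S ≤ 2) (h1 : 1 ∈ S) {x y : A} (hx : x ∈ S) (hy : y ∈ S) : x * y = y * x := by
  by_cases hli : LinearIndependent F ![1, x]
  · have hspan : Submodule.span F {1, x} = S := by
      refine Submodule.eq_of_le_of_finrank_le (Submodule.span_le.2 (Set.pair_subset h1 hx)) ?_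
      rwa [← Matrix.range_cons_cons_empty, finrank_span_eq_card hli, Fintype.card_fin]
    obtain ⟨a, b, rfl⟩ := Submodule.mem_span_pair.1 (hspan ▸ hy)
    simp only [mul_add, add_mul, mul_smul_comm, smul_mul_assoc, mul_one, one_mul]
  · rw [LinearIndependent.pair_iff' one_ne_zero] at hli
    push Not at hli
    obtain ⟨a, rfl⟩ := hli
    rw [smul_one_mul, mul_smul_one]

-- The key step of the Cartan–Brauer–Hua theorem: compare the conjugates of `k` by `x` and `x + 1`.
theorem commute_of_conj_mem {E : Subfield D} (hE : ∀ k ∈ E, ∀ y ≠ 0, y * k * y⁻¹ ∈ E)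
    {x k : D} (hx : x ∉ E) (hk : k ∈ E) : x * k = k * x := by
  have hx0 : x ≠ 0 := fun h => hx (h ▸ E.zero_mem)
  have hx1 : x + 1 ≠ 0 := fun h => hx (eq_neg_of_add_eq_zero_left h ▸ E.neg_mem E.one_mem)
  obtain ⟨u, hu, hxu⟩ : ∃ u ∈ E, x * k = u * x :=
    ⟨_, hE k hk x hx0, (inv_mul_cancel_right₀ hx0 _).symm⟩
  obtain ⟨v, hv, hxv⟩ : ∃ v ∈ E, (x + 1) * k = v * (x + 1) :=
    ⟨_, hE k hk _ hx1, (inv_mul_cancel_right₀ hx1 _).symm⟩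
  have hlin : (u - v) * x = v - k := by
    rw [add_mul, one_mul, hxu, mul_add, mul_one] at hxv
    rw [sub_mul, sub_eq_sub_iff_add_eq_add, hxv, add_comm]
  have huv : u = v := by
    by_contra hne
    refine hx ?_
    rw [← inv_mul_cancel_left₀ (sub_ne_zero.2 hne) x, hlin]
    exact E.mul_mem (E.inv_mem (E.sub_mem hu hv)) (E.sub_mem hv hk)
  rw [hxu, huv, ← sub_eq_zero.1 (hlin.symm.trans (by rw [huv, sub_self, zero_mul]))]

/-- The symmetric elements form a subfield as soon as they commute with each other. -/
def symSubfield (hcomm : ∀ x ∈ Sym θ, ∀ y ∈ Sym θ, x * y = y * x) : Subfield D where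
  carrier := Sym θ
  add_mem' := (Sym θ).add_mem
  zero_mem' := (Sym θ).zero_mem
  neg_mem' := (Sym θ).neg_mem
  one_mem' := one_mem_sym
  mul_mem' {x y} hx hy := mem_sym.2 (by
    rw [θ.apply_mul, mem_sym.1 hx, mem_sym.1 hy, hcomm y hy x hx])
  inv_mem' x hx := mem_sym.2 (by rw [θ.apply_inv, mem_sym.1 hx])

theorem conj_mem_sym (hcomm : ∀ x ∈ Sym θ, ∀ y ∈ Sym θ, x * y = y * x)
    {k : D} (hk : k ∈ Sym θ) {y : D} (hy : y ≠ 0) : y * k * y⁻¹ ∈ Sym θ := by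
  have hnorm : θ y * y ∈ Sym θ := mem_sym.2 (by rw [θ.apply_mul, θ.apply_apply])
  have hk_norm : θ y * y * k = k * (θ y * y) := hcomm _ hnorm k hk
  rw [mem_sym, θ.apply_mul, θ.apply_mul, θ.apply_inv, mem_sym.1 hk,
    inv_mul_eq_iff_eq_mul₀ (FInvolution.apply_ne_zero hy), ← mul_assoc, ← mul_assoc, hk_norm,
    ← mul_assoc, mul_inv_cancel_right₀ hy]

theorem mul_comm_of_mem_sym (hcomm : ∀ x ∈ Sym θ, ∀ y ∈ Sym θ, x * y = y * x)
    {k : D} (hk : k ∈ Sym θ) (x : D) : x * k = k * x := by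
  by_cases hx : x ∈ Sym θ
  · exact hcomm x hx k hk
  · exact commute_of_conj_mem (E := symSubfield hcomm)
      (fun k hk y hy => conj_mem_sym hcomm hk hy) hx hk

theorem finrank_sym_le_one [Algebra.IsCentral F D]
    (hcomm : ∀ x ∈ Sym θ, ∀ y ∈ Sym θ, x * y = y * x) : finrank F (Sym θ) ≤ 1 := by
  have hle : Sym θ ≤ F ∙ (1 : D) := fun k hk => by
    obtain ⟨c, rfl⟩ := Algebra.IsCentral.mem_center_iff (K := F) |>.1
      (Subalgebra.mem_center_iff.2 (mul_comm_of_mem_sym hcomm hk))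
    exact Submodule.mem_span_singleton.2 ⟨c, (Algebra.algebraMap_eq_smul_one c).symm⟩
  exact (Submodule.finrank_mono hle).trans ((finrank_span_le_card _).trans_eq (Set.toFinset_card _))

theorem finrank_alt_eq_one [CharP F 2] [Algebra.IsCentral F D] (hD : finrank F D = 4) :
    finrank F (Alt θ) = 1 := by
  have : Module.Finite F D := Module.finite_of_finrank_pos (by omega)
  have hsum := finrank_alt_add_finrank_sym (θ := θ)
  have hle := Submodule.finrank_mono (alt_le_sym (θ := θ))
  have hne_two : finrank F (Sym θ) ≠ 2 := fun h => by
    have := finrank_sym_le_one fun x hx y hy =>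
      mul_comm_of_finrank_le_two h.le (one_mem_sym (θ := θ)) hx hy
    omega
  have hne_four : finrank F (Sym θ) ≠ 4 := fun h => by
    have htop : Sym θ = ⊤ := Submodule.eq_top_of_finrank_eq (h.trans hD.symm)
    have hfix : ∀ x, θ x = x := fun x => mem_sym.1 (htop ▸ Submodule.mem_top)
    have := finrank_sym_le_one (θ := θ) fun x _ y _ => by
      rw [← hfix (x * y), θ.apply_mul, hfix, hfix]
    omega
  omega

theorem finrank_symModAlt_eq_two [CharP F 2] [Algebra.IsCentral F D] (hD : finrank F D = 4) :
    finrank F (SymModAlt θ) = 2 := by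
  have : Module.Finite F D := Module.finite_of_finrank_pos (by omega)
  have hsum := finrank_symModAlt_add (θ := θ)
  rw [finrank_alt_eq_one hD] at hsum
  omega

end CommutingSymmetric

section Forms

variable {F D : Type*} [Field F]

section Ring

variable [Ring D] [Algebra F D] {θ : FInvolution F D}
  {V : Type*} [AddCommGroup V] [Module Dᵐᵒᵖ V]

theorem HermForm.form_op_smul_right (φ : HermForm θ V) (x y : V) (d : D) :
    φ.form x (MulOpposite.op d • y) = φ.form x y * d := by
  have h := φ.map_smul_smul x y 1 d
  rwa [MulOpposite.op_one, one_smul, θ.apply_one, one_mul] at h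

theorem HermForm.form_eq_zero_symm (φ : HermForm θ V) {x y : V} (h : φ.form x y = 0) :
    φ.form y x = 0 := by
  rw [φ.symm, h, map_zero]

/-- The linear map `h(x, ·)` of right `D`-modules attached to a hermitian form `h`. -/
def HermForm.toLinearMapRight (φ : HermForm θ V) (x : V) : V →ₗ[Dᵐᵒᵖ] D where
  toFun := φ.form x
  map_add' := map_add _
  map_smul' d y := φ.form_op_smul_right x y d.unop

/-- The hermitian form `φ` is a polar form of the quadratic form `ρ`. -/
def QuadForm.HasPolar (ρ : QuadForm θ V) (φ : HermForm θ V) : Prop :=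
  ∀ x y : V, ρ.form (x + y) - ρ.form x - ρ.form y = (Alt θ).mkQ (φ.form x y)

variable [Module F V] [IsScalarTower F Dᵐᵒᵖ V]

theorem smul_eq_op_algebraMap_smul (c : F) (x : V) :
    c • x = MulOpposite.op (algebraMap F D c) • x := by
  rw [← MulOpposite.algebraMap_apply, algebraMap_smul]

theorem HermForm.form_smul_right (φ : HermForm θ V) (x y : V) (c : F) :
    φ.form x (c • y) = c • φ.form x y := by
  rw [smul_eq_op_algebraMap_smul (D := D), φ.form_op_smul_right, ← Algebra.commutes,
    Algebra.smul_def]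

/-- A hermitian form as an `F`-bilinear map. -/
def HermForm.toBilinMap (φ : HermForm θ V) : LinearMap.BilinMap F V D :=
  LinearMap.mk₂ F (fun x y => φ.form x y) (fun x y z => by rw [map_add, AddMonoidHom.add_apply])
    (fun c x y => by rw [φ.symm, φ.form_smul_right, map_smul, ← φ.symm])
    (fun x y z => map_add _ _ _) (fun c x y => φ.form_smul_right x y c)

/-- The quadratic map `x ↦ h(x, x)` over `F` attached to a hermitian form `h`. -/
def HermForm.toQuadraticMap (φ : HermForm θ V) : QuadraticMap F V D :=
  φ.toBilinMap.toQuadraticMap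

theorem HermForm.polar_toQuadraticMap (φ : HermForm θ V) (x y : V) :
    polar φ.toQuadraticMap x y = φ.form x y + θ (φ.form x y) := by
  rw [← φ.symm]
  exact LinearMap.BilinMap.polar_toQuadraticMap ..

/-- A generalised quadratic form as a quadratic map over `F` with values in `D / Alt(D, θ)`. -/
def QuadForm.toQuadraticMap (ρ : QuadForm θ V) : QuadraticMap F V (D ⧸ Alt θ) where
  toFun := ρ.form
  toFun_smul c x := by
    rw [smul_eq_op_algebraMap_smul (D := D), ρ.map_smul, conjQuot_algebraMap]
  exists_companion' := by
    obtain ⟨φ, hφ⟩ := ρ.exists_polar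
    refine ⟨φ.toBilinMap.compr₂ (Alt θ).mkQ, fun x y => ?_⟩
    rw [LinearMap.compr₂_apply, ← sub_eq_iff_eq_add', ← sub_sub]
    exact hφ x y

end Ring

section DivisionRing

variable [DivisionRing D] [Algebra F D] {θ : FInvolution F D}
  {V : Type*} [AddCommGroup V] [Module Dᵐᵒᵖ V]

theorem eq_zero_of_forall_mul_mem {A : Submodule F D} (hA : A ≠ ⊤) {c : D}
    (hc : ∀ d, c * d ∈ A) : c = 0 := by
  by_contra hne
  refine hA ((Submodule.eq_top_iff').2 fun y => ?_)
  simpa only [mul_inv_cancel_left₀ hne] using hc (c⁻¹ * y)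

theorem QuadForm.HasPolar.form_self_eq {ρ : QuadForm θ V} {φ : HermForm θ V}
    (hφ : ρ.HasPolar φ) (hA : Alt θ ≠ ⊤) {x : V} {a : D} (ha : ρ.form x = (Alt θ).mkQ a) :
    φ.form x x = a + θ a := by
  refine (sub_eq_zero.1 (eq_zero_of_forall_mul_mem hA fun d => ?_)).symm
  have hpolar : θ (1 + d) * (a * (1 + d)) - a - θ d * (a * d) - φ.form x x * d ∈ Alt θ := by
    have h := hφ x (MulOpposite.op d • x)
    rw [show x + MulOpposite.op d • x = MulOpposite.op (1 + d) • x by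
      rw [MulOpposite.op_add, add_smul, MulOpposite.op_one, one_smul], ρ.map_smul, ρ.map_smul, ha,
      conjQuot_mkQ, conjQuot_mkQ, φ.form_op_smul_right, ← map_sub, ← map_sub] at h
    exact (Submodule.Quotient.eq _).1 h
  have halt : θ d * a - θ (θ d * a) ∈ Alt θ := sub_apply_mem_alt _
  rw [θ.apply_mul, θ.apply_apply] at halt
  rw [map_add, θ.apply_one] at hpolar
  convert (Alt θ).sub_mem hpolar halt using 1
  noncomm_ring

theorem QuadForm.HasPolar.form_self_mem_alt [CharP F 2] {ρ : QuadForm θ V} {φ : HermForm θ V}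
    (hφ : ρ.HasPolar φ) (x : V) : φ.form x x ∈ Alt θ := by
  obtain ⟨a, ha⟩ := (Alt θ).mkQ_surjective (ρ.form x)
  rw [hφ.form_self_eq alt_ne_top ha.symm]
  exact add_apply_mem_alt a

theorem QuadForm.HasPolar.form_mem_symModAlt [CharP F 2] {ρ : QuadForm θ V} {φ : HermForm θ V}
    (hφ : ρ.HasPolar φ) {x : V} (hx : φ.form x x = 0) : ρ.form x ∈ SymModAlt θ := by
  obtain ⟨a, ha⟩ := (Alt θ).mkQ_surjective (ρ.form x)
  rw [hφ.form_self_eq alt_ne_top ha.symm, add_eq_sub_of_charTwo F, sub_eq_zero] at hx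
  exact ⟨a, mem_sym.2 hx.symm, ha⟩

variable [Module F V] [IsScalarTower F Dᵐᵒᵖ V]

theorem finrank_restrictScalars_eq_mul (W : Submodule Dᵐᵒᵖ V) :
    finrank F (W.restrictScalars F) = finrank F D * finrank Dᵐᵒᵖ W := by
  rw [(MulOpposite.opLinearEquiv F (M := D)).finrank_eq]
  exact (finrank_mul_finrank F Dᵐᵒᵖ W).symm

theorem finrank_op_self : finrank Dᵐᵒᵖ D = 1 :=
  finrank_eq_one 1 one_ne_zero fun y => ⟨MulOpposite.op y, one_mul y⟩

variable [CharP F 2] [Module.Finite F D] [Module.Finite F V]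
  [Module.Finite (frobenius F 2).fieldRange F]

theorem HermForm.IsAnisotropic.finrank_mul_finrank_le {φ : HermForm θ V} (hφ : φ.IsAnisotropic) :
    finrank F D * finrank Dᵐᵒᵖ V ≤
      (finrank F (SymModAlt θ) + finrank F (Alt θ) * (finrank F (Alt θ) + 1)) *
        finrank (frobenius F 2).fieldRange F := by
  let q : QuadraticMap F V D := φ.toQuadraticMap
  have hpolar : ∀ x y, polar ((Alt θ).mkQ.compQuadraticMap q) x y = 0 := fun x y => by
    refine (polar_comp q (Alt θ).mkQ x y).trans ((Submodule.Quotient.mk_eq_zero _).2 ?_)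
    exact φ.polar_toQuadraticMap (F := F) x y ▸ add_apply_mem_alt _
  have hsym : ∀ x, (Alt θ).mkQ (q x) ∈ SymModAlt θ := fun x =>
    Submodule.mem_map_of_mem (mem_sym.2 (φ.symm x x).symm)
  let f := (frobeniusSemilinear _ hpolar).codRestrict (SymModAlt θ) hsym
  have hker := finrank_le_of_anisotropic_of_mem
    (q := q.comp (LinearMap.ker f).subtype) (N := Alt θ)
    (fun x hx => Subtype.ext (by_contra fun hne => hφ x hne hx))
    fun x => (Submodule.Quotient.mk_eq_zero _).1 (congrArg Subtype.val (LinearMap.mem_ker.1 x.2))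
  have hV := finrank_le_finrank_ker_add f
  have hD := finrank_restrictScalars_eq_mul (F := F) (⊤ : Submodule Dᵐᵒᵖ V)
  rw [Submodule.restrictScalars_top, finrank_top, finrank_top] at hD
  linarith

theorem QuadForm.IsAnisotropic.finrank_mul_finrank_le {ρ : QuadForm θ V} (hρ : ρ.IsAnisotropic) :
    finrank F D * finrank Dᵐᵒᵖ V ≤
      (2 * finrank F (SymModAlt θ) + finrank F (Alt θ) * (finrank F (Alt θ) + 1)) *
        finrank (frobenius F 2).fieldRange F := by
  have : Module.Finite Dᵐᵒᵖ V := Module.Finite.of_restrictScalars_finite F Dᵐᵒᵖ V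
  have : Module.Finite Dᵐᵒᵖ D := Module.finite_of_finrank_pos (by rw [finrank_op_self]; omega)
  obtain ⟨φ, hφ⟩ : ∃ φ, ρ.HasPolar φ := ρ.exists_polar
  obtain ⟨W, C, hW, hC, hV⟩ := exists_isotropic_anisotropic (ψ := φ.toLinearMapRight)
    fun x y => φ.form_eq_zero_symm
  have hWzero : ∀ x ∈ W, ∀ y ∈ W, φ.form x y = 0 := fun x hx y hy => mem_orthogonal.1 (hW hy) x hx
  have hW_le := finrank_le_of_anisotropic_of_polar_eq_zero
    (q := (ρ.toQuadraticMap (F := F)).comp (W.restrictScalars F).subtype) (N := SymModAlt θ)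
    (fun x hx => Subtype.ext (by_contra fun hne => hρ x hne hx))
    (fun x y => (hφ x y).trans (by rw [hWzero x x.2 y y.2, map_zero]))
    fun x => hφ.form_mem_symModAlt (hWzero x x.2 x x.2)
  have hC_le := finrank_le_of_anisotropic_of_mem
    (q := (φ.toQuadraticMap (F := F)).comp (C.restrictScalars F).subtype) (N := Alt θ)
    (fun x hx => Subtype.ext (hC x x.2 hx)) fun x => hφ.form_self_mem_alt x
  rw [finrank_restrictScalars_eq_mul] at hW_le hC_le
  rw [finrank_op_self] at hV
  calc finrank F D * finrank Dᵐᵒᵖ V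
      ≤ finrank F D * (2 * finrank Dᵐᵒᵖ W + finrank Dᵐᵒᵖ C) := Nat.mul_le_mul_left _ hV
    _ ≤ _ := by linarith

end DivisionRing

end Forms

section Invariants

variable {F D : Type*} [Field F] [CharP F 2] [DivisionRing D] [Algebra F D] [Module.Finite F D]

theorem degSq_eq_finrank [Module.Finite (frobenius F 2).fieldRange F] :
    degSq F = finrank (frobenius F 2).fieldRange F := by
  rw [degSq, ← finrank_eq_rank, Cardinal.toENat_nat]

theorem degSq_eq_top (h : ¬ Module.Finite (frobenius F 2).fieldRange F) : degSq F = ⊤ :=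
  Cardinal.toENat_eq_top.2 (not_lt.1 fun hlt => h (rank_lt_aleph0_iff.1 hlt))

theorem natCast_le_mul_degSq {m c : ℕ} (hc : c ≠ 0)
    (h : Module.Finite (frobenius F 2).fieldRange F →
      m ≤ c * finrank (frobenius F 2).fieldRange F) :
    (m : ℕ∞) ≤ c * degSq F := by
  by_cases hF : Module.Finite (frobenius F 2).fieldRange F
  · rw [degSq_eq_finrank]
    exact_mod_cast h hF
  · rw [degSq_eq_top hF, ENat.mul_top (Nat.cast_ne_zero.2 hc)]
    exact le_top

variable (θ : FInvolution F D)

theorem finrank_mul_uPlus_le :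
    finrank F D * uPlus θ ≤
      (finrank F (SymModAlt θ) + finrank F (Alt θ) * (finrank F (Alt θ) + 1) : ℕ) * degSq F := by
  have hD : 0 < finrank F (SymModAlt θ) + 2 * finrank F (Alt θ) :=
    finrank_symModAlt_add (θ := θ) ▸ finrank_pos
  rw [uPlus, ENat.mul_sSup]
  refine iSup₂_le ?_
  rintro _ ⟨V, _, _, _, φ, hφ, rfl⟩
  let : Module F V := Module.compHom V (algebraMap F Dᵐᵒᵖ)
  have : IsScalarTower F Dᵐᵒᵖ V := IsScalarTower.of_algebraMap_smul fun _ _ => rfl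
  have : Module.Finite F V := Module.Finite.trans Dᵐᵒᵖ V
  rw [← Nat.cast_mul]
  refine natCast_le_mul_degSq (fun h => ?_) fun _ => hφ.finrank_mul_finrank_le
  have hAlt := mul_eq_zero.1 (Nat.add_eq_zero_iff.1 h).2
  omega

theorem finrank_mul_uInv_le :
    finrank F D * uInv θ ≤
      (2 * finrank F (SymModAlt θ) + finrank F (Alt θ) * (finrank F (Alt θ) + 1) : ℕ) *
        degSq F := by
  have hD : 0 < finrank F (SymModAlt θ) + 2 * finrank F (Alt θ) :=
    finrank_symModAlt_add (θ := θ) ▸ finrank_pos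
  rw [uInv, ENat.mul_sSup]
  refine iSup₂_le ?_
  rintro _ ⟨V, _, _, _, ρ, hρ, rfl⟩
  let : Module F V := Module.compHom V (algebraMap F Dᵐᵒᵖ)
  have : IsScalarTower F Dᵐᵒᵖ V := IsScalarTower.of_algebraMap_smul fun _ _ => rfl
  have : Module.Finite F V := Module.Finite.trans Dᵐᵒᵖ V
  rw [← Nat.cast_mul]
  refine natCast_le_mul_degSq (fun h => ?_) fun _ => hρ.finrank_mul_finrank_le
  have hAlt := mul_eq_zero.1 (Nat.add_eq_zero_iff.1 h).2
  omega

theorem toENNReal_le_div_mul {m n : ℕ} (hn : n ≠ 0) {u d : ℕ∞} (h : n * u ≤ m * d) :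
    (u : ℝ≥0∞) ≤ m / n * d := by
  rw [← ENNReal.mul_div_right_comm, ENNReal.le_div_iff_mul_le (.inl (Nat.cast_ne_zero.2 hn))
    (.inl (ENNReal.natCast_ne_top n)), mul_comm]
  exact_mod_cast ENat.toENNReal_le.2 h

end Invariants

end GenForm

theorem mainTheorem5_general {F D : Type*} [Field F] [CharP F 2] [DivisionRing D] [Algebra F D]
    [Module.Finite F D] (θ : GenForm.FInvolution F D) :
    Module.finrank F D * GenForm.uPlus θ ≤
      (Module.finrank F (GenForm.SymModAlt θ) + Module.finrank F (GenForm.Alt θ) *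
        (Module.finrank F (GenForm.Alt θ) + 1) : ℕ) * GenForm.degSq F ∧
    Module.finrank F D * GenForm.uInv θ ≤
      (2 * Module.finrank F (GenForm.SymModAlt θ) + Module.finrank F (GenForm.Alt θ) *
        (Module.finrank F (GenForm.Alt θ) + 1) : ℕ) * GenForm.degSq F :=
  ⟨GenForm.finrank_mul_uPlus_le θ, GenForm.finrank_mul_uInv_le θ⟩

theorem mainTheorem5 {F : Type*} [Field F] [CharP F 2]
    {Q : Type*} [DivisionRing Q] [Algebra F Q] [Algebra.IsCentral F Q]
    (hQ : Module.finrank F Q = 4) (θ : GenForm.FInvolution F Q) :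
    GenForm.uPlus θ ≤ GenForm.degSq F ∧
    (GenForm.uInv θ : ℝ≥0∞) ≤ (3 / 2 : ℝ≥0∞) * (GenForm.degSq F : ℝ≥0∞) := by
  have : Module.Finite F Q := Module.finite_of_finrank_pos (by omega)
  have hcoeff : ((2 * 2 + 1 * (1 + 1) : ℕ) / (4 : ℕ) : ℝ≥0∞) = 3 / 2 := by
    rw [ENNReal.div_eq_div_iff (by simp) (by simp) (by simp) (by simp)]
    norm_num
  obtain ⟨hPlus, hInv⟩ := mainTheorem5_general θ
  rw [hQ, GenForm.finrank_alt_eq_one hQ, GenForm.finrank_symModAlt_eq_two hQ] at hPlus hInv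
  exact ⟨(ENat.mul_le_mul_left_iff four_ne_zero (ENat.natCast_ne_top 4)).1 hPlus,
    hcoeff ▸ GenForm.toENNReal_le_div_mul four_ne_zero hInv⟩
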